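/- Let $K$ be a function field in one variable over a finite field $\mathbb{F}_q$, i.e. a finite extension of the rational function field $\mathbb{F}_q(x)$, whose full field of constants is $\mathbb{F}_q$ (every element of $K$ algebraic over $\mathbb{F}_q$ lies in $\mathbb{F}_q$), and suppose that $q \equiv -1 \pmod 3$. For a place $\mathfrak{p}$ of $K$ let $v_{\mathfrak{p}} : K \to \mathbb{Z} \cup \{\infty\}$ be its normalized valuation; for a place $\mathfrak{P}$ over $\mathfrak{p}$ of a finite extension $L$ of $K$, the ramification index $e(\mathfrak{P}|\mathfrak{p})$ is the unique positive integer with $v_{\mathfrak{P}}(z) = e(\mathfrak{P}|\mathfrak{p})\, v_{\mathfrak{p}}(z)$ for all $z \in K$. The place $\mathfrak{p}$ is ramified in $L$ if $e(\mathfrak{P}|\mathfrak{p}) > 1$ for some $\mathfrak{P}$ over $\mathfrak{p}$, and fully ramified if $e(\mathfrak{P}|\mathfrak{p}) = [L:K]$ for some $\mathfrak{P}$ over $\mathfrak{p}$. Let $L/K$ be a Galois extension of degree $3$. Then there is a primitive element $y$ of $L/K$ whose minimal polynomial over $K$ is $X^3 - 3X - a$ for some $a \in K$. Moreover, for every such $y$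 and $a$ and every place $\mathfrak{p}$ of $K$, the following are equivalent: 1. $\mathfrak{p}$ is ramified in $L$; 2. $\mathfrak{p}$ is fully ramified in $L$; 3. $v_{\mathfrak{p}}(a) < 0$ and $\gcd(v_{\mathfrak{p}}(a), 3) = 1$. -/

import Mathlib

open Polynomial IntermediateField

/-- A place of a function field `F` over the constant field `k`, given by its normalized discrete
valuation `v : F → ℤ ∪ {∞}`: a surjective valuation which is trivial on `k`. -/
structure Place (k F : Type*) [Field k] [Field F] [Algebra k F] where
  v : AddValuation F (WithTop ℤ)
  surjective_v : Function.Surjective v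
  v_const : ∀ c : k, c ≠ 0 → v (algebraMap k F c) = 0

namespace Place

/-- `P` lies over `p`: the valuation ring of `P` meets `K` in the valuation ring of `p`. -/
def LiesOver {k K L : Type*} [Field k] [Field K] [Field L] [Algebra k K] [Algebra k L]
    [Algebra K L] (P : Place k L) (p : Place k K) : Prop :=
  ∀ z : K, 0 ≤ P.v (algebraMap K L z) ↔ 0 ≤ p.v z

/-- The ramification index `e(P|p)`: the positive integer `e` such that `v_P(z) = e * v_p(z)` for
all `z` in `K`. It exists and is unique if `P` lies over `p`, see `existsUnique_ramificationIdx`. -/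
noncomputable def ramificationIdx {k K L : Type*} [Field k] [Field K] [Field L] [Algebra k K]
    [Algebra k L] [Algebra K L] (P : Place k L) (p : Place k K) : ℕ :=
  sInf {e : ℕ | 0 < e ∧ ∀ z : K, P.v (algebraMap K L z) = e • p.v z}

/-- `p` is ramified in `L`: some place of `L` over `p` has ramification index greater than 1. -/
def IsRamified {k K : Type*} (L : Type*) [Field k] [Field K] [Field L] [Algebra k K]
    [Algebra k L] [Algebra K L] (p : Place k K) : Prop :=
  ∃ P : Place k L, P.LiesOver p ∧ 1 < P.ramificationIdx p

/-- `p` is fully ramified in `L`: some place of `L` over `p` has ramification index `[L : K]`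
(it is then the only place of `L` over `p`). -/
def IsFullyRamified {k K : Type*} (L : Type*) [Field k] [Field K] [Field L] [Algebra k K]
    [Algebra k L] [Algebra K L] (p : Place k K) : Prop :=
  ∃ P : Place k L, P.LiesOver p ∧ P.ramificationIdx p = Module.finrank K L

/-- A unit of the valuation ring of `p` is a unit of the valuation ring of any `P` over `p`. -/
theorem LiesOver.map_eq_zero {k K L : Type*} [Field k] [Field K] [Field L] [Algebra k K]
    [Algebra k L] [Algebra K L] {P : Place k L} {p : Place k K} (h : P.LiesOver p) {u : K}
    (hu : p.v u = 0) : P.v (algebraMap K L u) = 0 := by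
  have hu0 : u ≠ 0 := by
    rintro rfl
    simp at hu
  have h1 : p.v u + p.v u⁻¹ = 0 := by rw [← p.v.map_mul, mul_inv_cancel₀ hu0, p.v.map_one]
  have h2 : p.v u⁻¹ = 0 := by rwa [hu, zero_add] at h1
  have h3 : P.v (algebraMap K L u) + P.v (algebraMap K L u⁻¹) = 0 := by
    rw [← P.v.map_mul, ← map_mul, mul_inv_cancel₀ hu0, map_one, P.v.map_one]
  have h4 := (h u).2 hu.ge
  have h5 := (h u⁻¹).2 h2.ge
  exact le_antisymm (le_trans (le_add_of_nonneg_right h5) h3.le) h4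

theorem existsUnique_ramificationIdx {k K L : Type*} [Field k] [Field K] [Field L] [Algebra k K]
    [Algebra k L] [Algebra K L] (P : Place k L) (p : Place k K) (h : P.LiesOver p) :
    ∃! e : ℕ, 0 < e ∧ ∀ z : K, P.v (algebraMap K L z) = e • p.v z := by
  obtain ⟨t, ht⟩ := p.surjective_v (1 : ℤ)
  have ht0 : t ≠ 0 := by
    rintro rfl
    simp at ht
  -- an element of nonnegative value `n` is `t ^ n` times a unit
  have key : ∀ (n : ℕ) (z : K), p.v z = ((n : ℤ) : WithTop ℤ) →
      P.v (algebraMap K L z) = n • P.v (algebraMap K L t) := by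
    intro n z hz
    have h1 : z = z / t ^ n * t ^ n := by field_simp
    have h2 : p.v (t ^ n) = ((n : ℤ) : WithTop ℤ) := by
      rw [p.v.map_pow, ht, ← WithTop.coe_nsmul]
      simp
    have h3 : p.v (z / t ^ n) = 0 := by
      have h4 := congrArg p.v h1
      rw [p.v.map_mul, hz, h2] at h4
      cases h5 : p.v (z / t ^ n) with
      | top => rw [h5] at h4; simp at h4
      | coe m =>
        rw [h5, ← WithTop.coe_add, WithTop.coe_inj] at h4
        have : m = 0 := by omega
        simp [this]
    rw [h1, map_mul, P.v.map_mul, h.map_eq_zero h3, zero_add, map_pow, P.v.map_pow]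
  have hinv : ∀ z : K, z ≠ 0 → P.v (algebraMap K L z) + P.v (algebraMap K L z⁻¹) = 0 := by
    intro z hz
    rw [← P.v.map_mul, ← map_mul, mul_inv_cancel₀ hz, map_one, P.v.map_one]
  have hinv' : ∀ z : K, z ≠ 0 → p.v z + p.v z⁻¹ = 0 := by
    intro z hz
    rw [← p.v.map_mul, mul_inv_cancel₀ hz, p.v.map_one]
  obtain ⟨d, hd⟩ : ∃ d : ℤ, P.v (algebraMap K L t) = d := by
    cases h5 : P.v (algebraMap K L t) with
    | top => have := hinv t ht0; rw [h5] at this; simp at this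
    | coe m => exact ⟨m, rfl⟩
  have hdpos : 0 < d := by
    by_contra! hneg
    have h1 := hinv t ht0
    have h2 := hinv' t ht0
    have h3 := h t⁻¹
    rw [ht] at h2
    rw [hd] at h1
    cases h5 : P.v (algebraMap K L t⁻¹) with
    | top => rw [h5] at h1; simp at h1
    | coe m =>
      cases h6 : p.v t⁻¹ with
      | top => rw [h6] at h2; simp at h2
      | coe r =>
        rw [h5, h6] at h3
        rw [h5] at h1
        rw [h6] at h2
        norm_cast at h1 h2 h3
        omega
  obtain ⟨e, rfl⟩ : ∃ e : ℕ, d = e := ⟨d.toNat, by omega⟩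
  have he : 0 < e := by exact_mod_cast hdpos
  refine ⟨e, ⟨he, ?_⟩, ?_⟩
  · intro z
    by_cases hz : z = 0
    · subst hz
      obtain ⟨e, rfl⟩ := Nat.exists_eq_succ_of_ne_zero he.ne'
      simp [succ_nsmul]
    have h2 := hinv' z hz
    have h1 := hinv z hz
    cases h6 : p.v z with
    | top => rw [h6] at h2; simp at h2
    | coe r =>
      rcases le_total 0 r with hr | hr
      · obtain ⟨n, rfl⟩ := Int.eq_ofNat_of_zero_le hr
        rw [key n z h6, hd, ← WithTop.coe_nsmul, ← WithTop.coe_nsmul]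
        simp [mul_comm]
      · obtain ⟨n, hn⟩ := Int.eq_ofNat_of_zero_le (neg_nonneg.2 hr)
        have h7 : p.v z⁻¹ = ((n : ℤ) : WithTop ℤ) := by
          cases h8 : p.v z⁻¹ with
          | top => rw [h8] at h2; simp at h2
          | coe s =>
            rw [h6, h8] at h2
            norm_cast at h2
            rw [WithTop.coe_inj]
            omega
        rw [key n _ h7, hd, ← WithTop.coe_nsmul] at h1
        cases h9 : P.v (algebraMap K L z) with
        | top => rw [h9] at h1; simp at h1
        | coe m =>
          rw [h9] at h1
          norm_cast at h1
          rw [← WithTop.coe_nsmul, WithTop.coe_inj]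
          obtain rfl : r = -n := by omega
          simp only [nsmul_eq_mul] at h1 ⊢
          linarith
  · rintro f ⟨-, hf⟩
    have := hf t
    rw [hd, ht, ← WithTop.coe_nsmul, WithTop.coe_inj] at this
    simpa using this.symm

theorem ramificationIdx_spec {k K L : Type*} [Field k] [Field K] [Field L] [Algebra k K]
    [Algebra k L] [Algebra K L] (P : Place k L) (p : Place k K) (h : P.LiesOver p) :
    0 < P.ramificationIdx p ∧
      ∀ z : K, P.v (algebraMap K L z) = P.ramificationIdx p • p.v z :=
  Nat.sInf_mem (existsUnique_ramificationIdx P p h).exists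

end Place

/-! ### Cube roots of unity and the constant field -/

section Constants

/-! Since q ≡ 2 mod 3, 3 is nonzero and K contains no primitive cube root of unity. An element of L
outside K, shifted to trace zero, satisfies x³ + px + r = 0. If p were 0, a conjugate quotient σx/x
would be a primitive cube root of unity of degree at most 2 over K, hence in K, which is impossible.
As (y - 1)²(y + 2) = y³ - 3y + 2, the element y = -3x²/p - 2 then satisfies y³ - 3y = a with a = -2
- 27r²/p³.

For P over p, powers of a uniformizer give e ≤ 3, and a parity argument on the values of conjugates
excludes e = 2 (`false_of_ramificationIdx_eq_two`), so ramified means fully ramified. If e = 3, an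
integral y outside K with y³ + by + d = 0 must have b and d of positive value
(`v_coeff_pos_of_depressed`). With b = -3 this forces a pole of a; after rescaling y by a power of a
uniformizer, it also forces the order to be prime to 3. Conversely, at a pole of a the term y³
dominates, so 3 v_P(y) = e v_p(a) and 3 divides e when v_p(a) is prime to 3. Some P over p exists by
`exists_liesOver`. -/

theorem three_ne_zero_of_card {k : Type*} [Field k] [Finite k]
    (hq : (Nat.card k : ℤ) ≡ -1 [ZMOD 3]) : (3 : k) ≠ 0 := by
  intro h3
  have := Fintype.ofFinite k
  obtain ⟨m, hm⟩ : ∃ m : ℕ, Nat.card k = 3 * m + 2 := by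
    have : (Nat.card k : ℤ) % 3 = 2 := hq
    exact ⟨Nat.card k / 3, by omega⟩
  have h0 : ((Nat.card k : ℕ) : k) = 0 := by
    rw [Nat.card_eq_fintype_card]
    exact Nat.cast_card_eq_zero k
  rw [hm] at h0
  push_cast at h0
  refine one_ne_zero (α := k) ?_
  linear_combination (1 + (m : k)) * h3 - h0

/-- A root satisfies c³ = 1, so c^q = c with q = 3m + 2 gives c² = c. Hence c = 1 and 3 = 0. -/
theorem sq_add_self_add_one_ne_zero_of_card {k : Type*} [Field k] [Finite k]
    (hq : (Nat.card k : ℤ) ≡ -1 [ZMOD 3]) (c : k) : c ^ 2 + c + 1 ≠ 0 := by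
  intro h
  have := Fintype.ofFinite k
  obtain ⟨m, hm⟩ : ∃ m : ℕ, Nat.card k = 3 * m + 2 := by
    have : (Nat.card k : ℤ) % 3 = 2 := hq
    exact ⟨Nat.card k / 3, by omega⟩
  have h3 : c ^ 3 = 1 := by linear_combination (c - 1) * h
  have h1 : c ^ Nat.card k = c := by
    rw [Nat.card_eq_fintype_card]
    exact FiniteField.pow_card c
  rw [hm, pow_add, pow_mul, h3, one_pow, one_mul] at h1
  have hc : c = 1 := by linear_combination h3 - (c + 1) * h1
  subst hc
  exact three_ne_zero_of_card hq (by linear_combination h)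

theorem sq_add_self_add_one_ne_zero_of_algebraicClosure_eq_bot {k K : Type*} [Field k] [Finite k]
    [Field K] [Algebra k K] (hconst : algebraicClosure k K = ⊥)
    (hq : (Nat.card k : ℤ) ≡ -1 [ZMOD 3]) (z : K) : z ^ 2 + z + 1 ≠ 0 := by
  intro h
  have hz : z ∈ algebraicClosure k K := by
    rw [mem_algebraicClosure_iff]
    refine ⟨X ^ 2 + X + 1, ?_, by simpa using h⟩
    have : (X ^ 2 + X + 1 : k[X]).Monic := by monicity!
    exact this.ne_zero
  rw [hconst, IntermediateField.mem_bot] at hz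
  obtain ⟨c, rfl⟩ := hz
  refine sq_add_self_add_one_ne_zero_of_card hq c ((algebraMap k K).injective ?_)
  simpa using h

end Constants

/-! ### The normal form X³ - 3X - a of a cubic Galois extension -/

section Cubic

variable {K L : Type*} [Field K] [Field L] [Algebra K L]

/-- In an extension of degree three there are no intermediate degrees. -/
theorem adjoin_eq_top_of_finrank_eq_three (hcubic : Module.finrank K L = 3) {y : L}
    (hy : y ∉ (algebraMap K L).range) : K⟮y⟯ = ⊤ := by
  have : FiniteDimensional K L := Module.finite_of_finrank_pos (by omega)
  have hmul := Module.finrank_mul_finrank K K⟮y⟯ L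
  rw [hcubic] at hmul
  have h1 : Module.finrank K K⟮y⟯ ≠ 1 := by
    intro h
    rw [IntermediateField.finrank_eq_one_iff, IntermediateField.adjoin_simple_eq_bot_iff,
      IntermediateField.mem_bot] at h
    exact hy h
  have h3 : Module.finrank K K⟮y⟯ = 3 :=
    ((Nat.dvd_prime Nat.prime_three).1 ⟨_, hmul.symm⟩).resolve_left h1
  exact IntermediateField.eq_of_le_of_finrank_eq le_top (by
    rw [h3, IntermediateField.finrank_top', hcubic])

theorem minpoly_natDegree_eq_three (hcubic : Module.finrank K L = 3) {y : L}
    (hy : y ∉ (algebraMap K L).range) : (minpoly K y).natDegree = 3 := by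
  have : FiniteDimensional K L := Module.finite_of_finrank_pos (by omega)
  rw [← IntermediateField.adjoin.finrank (Algebra.IsIntegral.isIntegral y),
    adjoin_eq_top_of_finrank_eq_three hcubic hy, IntermediateField.finrank_top', hcubic]

theorem minpoly_eq_of_finrank_eq_three (hcubic : Module.finrank K L = 3) {y : L}
    (hy : y ∉ (algebraMap K L).range) {P : K[X]} (hP : P.Monic) (hd : P.natDegree = 3)
    (h0 : aeval y P = 0) : minpoly K y = P := by
  have : FiniteDimensional K L := Module.finite_of_finrank_pos (by omega)
  refine (Polynomial.eq_of_monic_of_dvd_of_natDegree_le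
    (minpoly.monic (Algebra.IsIntegral.isIntegral y)) hP (minpoly.dvd K y h0) ?_).symm
  rw [hd, minpoly_natDegree_eq_three hcubic hy]

/-- The coefficients of the minimal polynomial of an element outside the base field. -/
theorem exists_minpoly_eq_cubic (hcubic : Module.finrank K L = 3) {y : L}
    (hy : y ∉ (algebraMap K L).range) : ∃ A B C' : K,
      y ^ 3 + algebraMap K L A * y ^ 2 + algebraMap K L B * y + algebraMap K L C' = 0 := by
  have : FiniteDimensional K L := Module.finite_of_finrank_pos (by omega)
  have hd := minpoly_natDegree_eq_three hcubic hy
  have hm := minpoly.monic (A := K) (Algebra.IsIntegral.isIntegral y)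
  have h := minpoly.aeval K y
  have h3 : (minpoly K y).coeff 3 = 1 := by rw [← hd]; exact hm
  rw [aeval_eq_sum_range, hd] at h
  simp only [Finset.sum_range_succ, Finset.sum_range_zero, Algebra.smul_def, h3] at h
  refine ⟨(minpoly K y).coeff 2, (minpoly K y).coeff 1, (minpoly K y).coeff 0, ?_⟩
  simp only [map_one] at h
  linear_combination h

/-- An element outside the base field with vanishing trace, its minimal polynomial having a nonzero
linear coefficient. -/
theorem exists_depressed_cubic [IsGalois K L] (hcubic : Module.finrank K L = 3) (h3 : (3 : K) ≠ 0)
    (hζ : ∀ z : K, z ^ 2 + z + 1 ≠ 0) : ∃ (x : L) (p r : K), x ∉ (algebraMap K L).range ∧ p ≠ 0 ∧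
      x ^ 3 + algebraMap K L p * x + algebraMap K L r = 0 := by
  have : FiniteDimensional K L := Module.finite_of_finrank_pos (by omega)
  obtain ⟨θ, hθ⟩ : ∃ θ : L, θ ∉ (algebraMap K L).range := by
    by_contra! h
    have : (⊥ : IntermediateField K L) = ⊤ := by
      rw [eq_top_iff]
      intro x _
      exact IntermediateField.mem_bot.2 (h x)
    have h1 := IntermediateField.finrank_bot (F := K) (E := L)
    rw [this, IntermediateField.finrank_top', hcubic] at h1
    omega
  obtain ⟨A, B, C', h⟩ := exists_minpoly_eq_cubic hcubic hθ
  have h3L : (3 : L) ≠ 0 := by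
    rw [← map_ofNat (algebraMap K L)]
    exact (_root_.map_ne_zero _).2 h3
  -- The shift by A/3 completes the cube and removes the quadratic term.
  have hx : θ + algebraMap K L (A / 3) ∉ (algebraMap K L).range := by
    rintro ⟨c, hc⟩
    exact hθ ⟨c - A / 3, by rw [map_sub, hc]; ring⟩
  have key : (θ + algebraMap K L (A / 3)) ^ 3
      + algebraMap K L (B - A ^ 2 / 3) * (θ + algebraMap K L (A / 3))
      + algebraMap K L (C' - A * B / 3 + 2 * A ^ 3 / 27) = 0 := by
    have h27 : (27 : L) ≠ 0 := by
      have : (27 : L) = 3 ^ 3 := by norm_num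
      rw [this]
      exact pow_ne_zero _ h3L
    simp only [map_div₀, map_sub, map_add, map_mul, map_pow, map_ofNat]
    rw [← h]
    field_simp
    ring
  refine ⟨_, _, _, hx, ?_, key⟩
  intro hp
  set x := θ + algebraMap K L (A / 3)
  rw [hp, map_zero, zero_mul, add_zero] at key
  obtain ⟨σ, hσ⟩ : ∃ σ : L ≃ₐ[K] L, σ x ≠ x := by
    by_contra! hfix
    exact hx ((IsGalois.mem_range_algebraMap_iff_fixed x).2 hfix)
  have hx0 : x ≠ 0 := by
    intro h0
    exact hx (by rw [h0]; exact zero_mem _)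
  have h2 := congrArg σ key
  rw [map_add, map_pow, AlgEquiv.commutes, map_zero] at h2
  -- Both x³ and (σx)³ equal the same element of K, so z is a nontrivial cube root of unity.
  set z := σ x / x with hz
  have hzx : σ x = z * x := by rw [hz]; field_simp
  have hz1 : z ≠ 1 := by
    intro h1
    rw [h1, one_mul] at hzx
    exact hσ hzx
  have hz3 : z ^ 2 + z + 1 = 0 := by
    rw [hzx] at h2
    have h4 : x ^ 3 * ((z - 1) * (z ^ 2 + z + 1)) = 0 := by linear_combination h2 - key
    simpa [hx0, sub_ne_zero.2 hz1] using h4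
  by_cases hzK : z ∈ (algebraMap K L).range
  · obtain ⟨c, hc⟩ := hzK
    refine hζ c ((algebraMap K L).injective ?_)
    simp [hc, hz3]
  · have hd := minpoly_natDegree_eq_three hcubic hzK
    have hm : (X ^ 2 + X + 1 : K[X]).Monic := by monicity!
    have h5 := natDegree_le_of_dvd (minpoly.dvd K z (p := X ^ 2 + X + 1) (by simpa using hz3))
      hm.ne_zero
    have h6 : (X ^ 2 + X + 1 : K[X]).natDegree ≤ 2 := by compute_degree
    omega

/-- With y + 2 = -3x²/p and y - 1 = -3(x² + p)/p, the relation x(x² + p) = -r gives (y - 1)²(y + 2)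
= -27r²/p³, which is a + 2. -/
theorem exists_minpoly_eq_X_pow_three_sub [IsGalois K L] (hcubic : Module.finrank K L = 3)
    (h3 : (3 : K) ≠ 0) (hζ : ∀ z : K, z ^ 2 + z + 1 ≠ 0) :
    ∃ (y : L) (a : K), K⟮y⟯ = ⊤ ∧ minpoly K y = X ^ 3 - 3 * X - C a := by
  obtain ⟨x, p, r, hx, hp, h⟩ := exists_depressed_cubic (L := L) hcubic h3 hζ
  have hpL : algebraMap K L p ≠ 0 := (_root_.map_ne_zero _).2 hp
  have h3L : (3 : L) ≠ 0 := by
    rw [← map_ofNat (algebraMap K L)]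
    exact (_root_.map_ne_zero _).2 h3
  have hy : -3 * x ^ 2 / algebraMap K L p - 2 ∉ (algebraMap K L).range := by
    rintro ⟨c, hc⟩
    -- If y were in K, so would be x². Then x(x² + p) = -r puts x in K, unless x² = -p, when x has
    -- degree at most 2.
    have hc2 : x ^ 2 = algebraMap K L (-(c + 2) * p / 3) := by
      simp only [map_div₀, map_mul, map_neg, map_add, map_ofNat, hc]
      field_simp
      ring
    have h4 : x * (algebraMap K L (-(c + 2) * p / 3 + p)) = algebraMap K L (-r) := by
      rw [map_add, ← hc2, map_neg]
      linear_combination h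
    by_cases h5 : -(c + 2) * p / 3 + p = 0
    · rw [h5, map_zero, mul_zero, eq_comm, map_eq_zero, neg_eq_zero] at h4
      have hd := minpoly_natDegree_eq_three hcubic hx
      have hm : (X ^ 2 + C p : K[X]).Monic := by monicity!
      have hx0 : x ≠ 0 := by
        intro h0
        exact hx (by rw [h0]; exact zero_mem _)
      have h8 : x ^ 2 + algebraMap K L p = 0 := by
        rw [h4, map_zero, add_zero] at h
        have : x * (x ^ 2 + algebraMap K L p) = 0 := by linear_combination h
        exact (mul_eq_zero.1 this).resolve_left hx0
      have h6 := natDegree_le_of_dvd (minpoly.dvd K x (p := X ^ 2 + C p) (by simpa using h8))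
        hm.ne_zero
      have h7 : (X ^ 2 + C p : K[X]).natDegree ≤ 2 := by compute_degree
      omega
    · refine hx ⟨-r / (-(c + 2) * p / 3 + p), ?_⟩
      rw [map_div₀, ← h4, mul_div_cancel_right₀ _ ((_root_.map_ne_zero _).2 h5)]
  refine ⟨_, -2 - 27 * r ^ 2 / p ^ 3, adjoin_eq_top_of_finrank_eq_three hcubic hy,
    minpoly_eq_of_finrank_eq_three hcubic hy ?_ ?_ ?_⟩
  · rw [show (3 : K[X]) = C 3 from rfl]
    monicity!
  · rw [show (3 : K[X]) = C 3 from rfl]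
    compute_degree!
  · have hr : algebraMap K L r = -(x ^ 3 + algebraMap K L p * x) := by linear_combination h
    simp only [map_sub, map_mul, map_pow, aeval_X, map_ofNat, aeval_C, map_neg, map_div₀, hr]
    field_simp
    ring

end Cubic

/-! ### Values of sums and integer-valued orders -/

/-- The value of a sum of elements with pairwise distinct values (or value `⊤`) is the smallest of these
values. -/
theorem AddValuation.map_sum_of_distinct {R Γ ι : Type*} [Ring R]
    [LinearOrderedAddCommMonoidWithTop Γ] (v : AddValuation R Γ) (f : ι → R) (s : Finset ι)
    (h : ∀ i ∈ s, ∀ j ∈ s, i ≠ j → v (f i) = v (f j) → v (f i) = ⊤) :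
    v (∑ i ∈ s, f i) = s.inf fun i => v (f i) := by
  classical
  induction s using Finset.induction_on with
  | empty => simp
  | insert a s ha ih =>
    have ih := ih fun i hi j hj =>
      h i (Finset.mem_insert_of_mem hi) j (Finset.mem_insert_of_mem hj)
    rw [Finset.sum_insert ha, Finset.inf_insert, ← ih]
    by_cases hne : v (f a) = v (∑ i ∈ s, f i)
    -- The value of the tail is attained by one of its terms, so a tie with the head is a tie
    -- between two terms.
    · have htop : v (f a) = ⊤ := by
        rcases s.eq_empty_or_nonempty with rfl | hs
        · simpa using hne
        · obtain ⟨i, hi, hie⟩ := Finset.exists_mem_eq_inf s hs fun i => v (f i)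
          refine h a (Finset.mem_insert_self _ _) i (Finset.mem_insert_of_mem hi) ?_ ?_
          · rintro rfl
            exact ha hi
          · rw [hne, ih, hie]
      rw [← hne, inf_idem, htop]
      exact top_le_iff.1 (v.map_le_add htop.ge (hne ▸ htop).ge)
    · exact v.map_add_of_distinct_val hne

namespace Place

section Ord

variable {k F : Type*} [Field k] [Field F] [Algebra k F] (P : Place k F)

/-- The value of a nonzero element as an integer. -/
noncomputable def ord (x : F) : ℤ := (P.v x).untopD 0

theorem v_eq_ord {x : F} (hx : x ≠ 0) : P.v x = (P.ord x : WithTop ℤ) := by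
  have h := P.v.ne_top_iff.2 hx
  cases h1 : P.v x with
  | top => exact absurd h1 h
  | coe n => simp [ord, h1]

theorem ord_eq_of_v_eq {x : F} {n : ℤ} (h : P.v x = n) : P.ord x = n := by
  simp [ord, h]

theorem ne_zero_of_v_eq {x : F} {n : ℤ} (h : P.v x = n) : x ≠ 0 := by
  rintro rfl
  simp at h

theorem ord_mul {x y : F} (hx : x ≠ 0) (hy : y ≠ 0) : P.ord (x * y) = P.ord x + P.ord y := by
  apply ord_eq_of_v_eq
  rw [P.v.map_mul, P.v_eq_ord hx, P.v_eq_ord hy]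
  rfl

theorem ord_pow {x : F} (hx : x ≠ 0) (n : ℕ) : P.ord (x ^ n) = n * P.ord x := by
  apply ord_eq_of_v_eq
  rw [P.v.map_pow, P.v_eq_ord hx, ← WithTop.coe_nsmul, nsmul_eq_mul]

theorem ord_div {x y : F} (hx : x ≠ 0) (hy : y ≠ 0) : P.ord (x / y) = P.ord x - P.ord y := by
  have h := P.ord_mul (div_ne_zero hx hy) hy
  rw [div_mul_cancel₀ _ hy] at h
  omega

theorem ord_zpow {x : F} (hx : x ≠ 0) (n : ℤ) : P.ord (x ^ n) = n * P.ord x := by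
  cases n with
  | ofNat n => simpa using P.ord_pow hx n
  | negSucc n =>
    have h1 : P.ord (1 : F) = 0 := P.ord_eq_of_v_eq (by simp)
    rw [zpow_negSucc, ← one_div, P.ord_div one_ne_zero (pow_ne_zero _ hx), P.ord_pow hx, h1,
      Int.negSucc_eq]
    push_cast
    ring

theorem ord_add_of_ne {x y : F} (hx : x ≠ 0) (hy : y ≠ 0) (h : P.ord x ≠ P.ord y) :
    x + y ≠ 0 ∧ P.ord (x + y) = min (P.ord x) (P.ord y) := by
  have h1 : P.v (x + y) = ((min (P.ord x) (P.ord y) : ℤ) : WithTop ℤ) := by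
    rw [P.v.map_add_of_distinct_val, P.v_eq_ord hx, P.v_eq_ord hy, WithTop.coe_min]
    rw [P.v_eq_ord hx, P.v_eq_ord hy]
    exact fun h' => h (WithTop.coe_injective h')
  exact ⟨P.ne_zero_of_v_eq h1, P.ord_eq_of_v_eq h1⟩

theorem exists_ord_eq_one : ∃ t : F, t ≠ 0 ∧ P.ord t = 1 := by
  obtain ⟨t, ht⟩ := P.surjective_v (1 : ℤ)
  exact ⟨t, P.ne_zero_of_v_eq ht, P.ord_eq_of_v_eq ht⟩

theorem v_eq_coe_iff {x : F} {n : ℤ} (hx : x ≠ 0) : P.v x = n ↔ P.ord x = n := by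
  rw [P.v_eq_ord hx, WithTop.coe_inj]

theorem v_nonneg_iff {x : F} (hx : x ≠ 0) : 0 ≤ P.v x ↔ 0 ≤ P.ord x := by
  rw [P.v_eq_ord hx]
  exact WithTop.coe_le_coe

theorem v_pos_iff {x : F} (hx : x ≠ 0) : 0 < P.v x ↔ 0 < P.ord x := by
  rw [P.v_eq_ord hx]
  exact WithTop.coe_lt_coe

theorem v_pos_mul {x y : F} (hx : 0 < P.v x) (hy : 0 ≤ P.v y) : 0 < P.v (x * y) := by
  rw [P.v.map_mul]
  exact add_pos_of_pos_of_nonneg hx hy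

theorem v_three (h3 : (3 : k) ≠ 0) : P.v (3 : F) = 0 := by
  rw [← map_ofNat (algebraMap k F)]
  exact P.v_const 3 h3

/-- A valuation ring is integrally closed, for equations `y ^ 3 + b * y + d = 0`. -/
theorem v_nonneg_of_cubic {y b d : F} (h : y ^ 3 + b * y + d = 0) (hb : 0 ≤ P.v b)
    (hd : 0 ≤ P.v d) : 0 ≤ P.v y := by
  by_cases hy : y = 0
  · simp [hy]
  rw [P.v_nonneg_iff hy]
  by_contra! hneg
  have h1 : P.v (y ^ 3) = ((3 * P.ord y : ℤ) : WithTop ℤ) := by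
    rw [P.v_eq_ord (pow_ne_zero _ hy), P.ord_pow hy]
    rfl
  have h2 : ((P.ord y : ℤ) : WithTop ℤ) ≤ P.v (-(b * y + d)) := by
    rw [P.v.map_neg]
    refine P.v.map_le_add ?_ ?_
    · rw [P.v.map_mul, ← P.v_eq_ord hy]
      exact le_add_of_nonneg_left hb
    · refine le_trans ?_ hd
      exact WithTop.coe_le_coe.2 hneg.le
  rw [show -(b * y + d) = y ^ 3 by linear_combination -h, h1, WithTop.coe_le_coe] at h2
  omega

end Ord

/-! ### Powers of a uniformizer and the bound e ≤ [L : K] -/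

variable {k K L : Type*} [Field k] [Field K] [Field L] [Algebra k K] [Algebra k L] [Algebra K L]
  {P : Place k L} {p : Place k K}

theorem LiesOver.ord_algebraMap (h : P.LiesOver p) (z : K) :
    P.ord (algebraMap K L z) = P.ramificationIdx p * p.ord z := by
  -- The default `ord 0 = 0` makes the formula hold at zero as well.
  by_cases hz : z = 0
  · simp [hz, ord]
  · apply ord_eq_of_v_eq
    rw [(ramificationIdx_spec P p h).2 z, p.v_eq_ord hz, ← WithTop.coe_nsmul, nsmul_eq_mul]

theorem LiesOver.ord_algebraMap_mul_pow (h : P.LiesOver p) {c : K} (hc : c ≠ 0) {x : L}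
    (hx : x ≠ 0) (i : ℕ) :
    P.ord (algebraMap K L c * x ^ i) = P.ramificationIdx p * p.ord c + i * P.ord x := by
  rw [P.ord_mul ((_root_.map_ne_zero _).2 hc) (pow_ne_zero _ hx), P.ord_pow hx, h.ord_algebraMap]

/-- Powers of a uniformizer with exponents below the ramification index have values in distinct
classes modulo the values of the base field. -/
theorem LiesOver.distinct_values (h : P.LiesOver p) {x : L} (hx : x ≠ 0) (hx1 : P.ord x = 1)
    (c : Fin (P.ramificationIdx p) → K) (i j : Fin (P.ramificationIdx p)) (hij : i ≠ j)
    (hv : P.v (algebraMap K L (c i) * x ^ (i : ℕ)) = P.v (algebraMap K L (c j) * x ^ (j : ℕ))) :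
    P.v (algebraMap K L (c i) * x ^ (i : ℕ)) = ⊤ := by
  by_contra htop
  have hi := (P.v.ne_top_iff).1 htop
  have hj := (P.v.ne_top_iff).1 (hv ▸ htop)
  have hci : c i ≠ 0 := fun h0 => hi (by simp [h0])
  have hcj : c j ≠ 0 := fun h0 => hj (by simp [h0])
  rw [P.v_eq_ord hi, P.v_eq_ord hj, WithTop.coe_inj, h.ord_algebraMap_mul_pow hci hx,
    h.ord_algebraMap_mul_pow hcj hx, hx1] at hv
  -- Modulo e the two values are the exponents i and j, both below e.
  have h1 := congrArg (· % (P.ramificationIdx p : ℤ)) hv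
  simp only [mul_one, Int.mul_add_emod_self_left] at h1
  rw [Int.emod_eq_of_lt (by omega) (by omega), Int.emod_eq_of_lt (by omega) (by omega)] at h1
  exact hij (Fin.ext (by exact_mod_cast h1))

theorem LiesOver.v_sum (h : P.LiesOver p) {x : L} (hx : x ≠ 0) (hx1 : P.ord x = 1)
    (c : Fin (P.ramificationIdx p) → K) (s : Finset (Fin (P.ramificationIdx p))) :
    P.v (∑ i ∈ s, algebraMap K L (c i) * x ^ (i : ℕ)) =
      s.inf fun i => P.v (algebraMap K L (c i) * x ^ (i : ℕ)) :=
  P.v.map_sum_of_distinct _ s fun i _ j _ => h.distinct_values hx hx1 c i j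

/-- The value of a combination is the minimum of the values of its terms; when the combination
vanishes, every term has value ⊤. -/
theorem LiesOver.linearIndependent_pow (h : P.LiesOver p) {x : L} (hx : x ≠ 0)
    (hx1 : P.ord x = 1) :
    LinearIndependent K fun i : Fin (P.ramificationIdx p) => x ^ (i : ℕ) := by
  rw [Fintype.linearIndependent_iff]
  intro c hc i
  simp only [Algebra.smul_def] at hc
  have h1 := h.v_sum hx hx1 c Finset.univ
  rw [hc, P.v.map_zero] at h1
  have h2 : P.v (algebraMap K L (c i) * x ^ (i : ℕ)) = ⊤ :=
    top_le_iff.1 (h1.le.trans (Finset.inf_le (Finset.mem_univ i)))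
  rw [P.v.top_iff] at h2
  simpa [hx] using h2

theorem LiesOver.ramificationIdx_le_finrank [FiniteDimensional K L] (h : P.LiesOver p) :
    P.ramificationIdx p ≤ Module.finrank K L := by
  obtain ⟨x, hx, hx1⟩ := P.exists_ord_eq_one
  simpa using (h.linearIndependent_pow hx hx1).fintype_card_le_finrank

end Place

/-! ### The Galois action, and ramification indices two and three -/

namespace Place

variable {k K L : Type*} [Field k] [Field K] [Field L] [Algebra k K] [Algebra k L] [Algebra K L]
  {P : Place k L} {p : Place k K}

/-- A group of order 3 is cyclic, and the norm is fixed by its generator, hence by the whole group.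
-/
theorem exists_generator_of_finrank_eq_three [IsGalois K L] (hcubic : Module.finrank K L = 3) :
    ∃ σ : L ≃ₐ[K] L, (∀ x, σ (σ (σ x)) = x) ∧
      ∀ x, x * σ x * σ (σ x) ∈ (algebraMap K L).range := by
  have : FiniteDimensional K L := Module.finite_of_finrank_pos (by omega)
  have hcard : Nat.card (L ≃ₐ[K] L) = 3 := by rw [IsGalois.card_aut_eq_finrank, hcubic]
  have : Fact (Nat.Prime 3) := ⟨Nat.prime_three⟩
  have := isCyclic_of_prime_card hcard
  obtain ⟨σ, hσ⟩ := IsCyclic.exists_generator (α := L ≃ₐ[K] L)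
  have hσ3 : ∀ x, σ (σ (σ x)) = x := by
    intro x
    have h1 : σ ^ 3 = 1 := by rw [← hcard]; exact pow_card_eq_one'
    have h2 := DFunLike.congr_fun h1 x
    simpa [pow_succ, AlgEquiv.mul_apply] using h2
  refine ⟨σ, hσ3, fun x => (IsGalois.mem_range_algebraMap_iff_fixed _).2 fun τ => ?_⟩
  have hle : Subgroup.zpowers σ ≤ MulAction.stabilizer (L ≃ₐ[K] L) (x * σ x * σ (σ x)) := by
    rw [Subgroup.zpowers_le, MulAction.mem_stabilizer_iff, AlgEquiv.smul_def, map_mul, map_mul,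
      hσ3]
    ring
  exact MulAction.mem_stabilizer_iff.1 (hle (hσ τ))

section IndexTwo

variable {σ : L ≃ₐ[K] L} (hσ : ∀ x, x * σ x * σ (σ x) ∈ (algebraMap K L).range)
  (h : P.LiesOver p) (h2 : P.ramificationIdx p = 2)
include hσ h h2

/-- The norm lies in K, whose nonzero elements have even value at P when e = 2. -/
theorem even_sum_ord {x : L} (hx : x ≠ 0) :
    (P.ord x + P.ord (σ x) + P.ord (σ (σ x))) % 2 = 0 := by
  have h1 : σ x ≠ 0 := by simpa using hx
  have h3 : σ (σ x) ≠ 0 := by simpa using hx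
  obtain ⟨c, hc⟩ := hσ x
  have h4 := h.ord_algebraMap c
  rw [hc, h2, P.ord_mul (mul_ne_zero hx h1) h3, P.ord_mul hx h1] at h4
  omega

/-- No even nonzero integer separates the odd values of `x` and `σ x` if `σ (σ x)` has value `0`. -/
theorem not_separated {x : L} (hx : x ≠ 0) (ha : P.ord x % 2 = 1) (hb : P.ord (σ x) % 2 = 1)
    (hc : P.ord (σ (σ x)) = 0) {j : ℤ} (hj : j ≠ 0) :
    ¬ (P.ord x < 2 * j ∧ 2 * j < P.ord (σ x)) ∧ ¬ (P.ord (σ x) < 2 * j ∧ 2 * j < P.ord x) := by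
  obtain ⟨t, ht, ht1⟩ := p.exists_ord_eq_one
  set u := algebraMap K L (t ^ j) with hu
  have hu0 : u ≠ 0 := (_root_.map_ne_zero _).2 (zpow_ne_zero _ ht)
  have hu1 : P.ord u = 2 * j := by
    rw [hu, h.ord_algebraMap, p.ord_zpow ht, ht1, h2]
    push_cast
    ring
  have hσu : σ u = u := σ.commutes _
  have h1 : σ x ≠ 0 := by simpa using hx
  have h3 : σ (σ x) ≠ 0 := by simpa using hx
  -- Adding u, an element of K, truncates all three values at 2j. If 2j separates the odd values,
  -- exactly one odd value survives and the norm of x + u has odd value.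
  have e0 := P.ord_add_of_ne hx hu0 (by omega)
  have e1 := P.ord_add_of_ne h1 hu0 (by omega)
  have e2 := P.ord_add_of_ne h3 hu0 (by omega)
  have := even_sum_ord hσ h h2 e0.1
  rw [map_add, map_add, hσu, hσu, e0.2, e1.2, e2.2] at this
  omega

/-- Dividing by u makes the third value 0. Cubing keeps parities and stretches a gap between the odd
values to at least 6, leaving room for a nonzero even integer. -/
theorem ord_eq_ord_of_odd {x : L} (hx : x ≠ 0) (ha : P.ord x % 2 = 1) (hb : P.ord (σ x) % 2 = 1)
    (hc : P.ord (σ (σ x)) % 2 = 0) : P.ord x = P.ord (σ x) := by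
  obtain ⟨t, ht, ht1⟩ := p.exists_ord_eq_one
  obtain ⟨j, hj⟩ : ∃ j, P.ord (σ (σ x)) = 2 * j := ⟨P.ord (σ (σ x)) / 2, by omega⟩
  set u := algebraMap K L (t ^ j) with hu
  have hu0 : u ≠ 0 := (_root_.map_ne_zero _).2 (zpow_ne_zero _ ht)
  have hu1 : P.ord u = 2 * j := by
    rw [hu, h.ord_algebraMap, p.ord_zpow ht, ht1, h2]
    push_cast
    ring
  have hσu : σ u = u := σ.commutes _
  have h1 : σ x ≠ 0 := by simpa using hx
  have h3 : σ (σ x) ≠ 0 := by simpa using hx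
  have key := fun i => not_separated hσ h h2 (x := (x / u) ^ 3) (j := i)
    (pow_ne_zero _ (div_ne_zero hx hu0))
  simp only [map_pow, map_div₀, hσu, P.ord_pow (div_ne_zero hx hu0),
    P.ord_pow (div_ne_zero h1 hu0), P.ord_pow (div_ne_zero h3 hu0), P.ord_div hx hu0,
    P.ord_div h1 hu0, P.ord_div h3 hu0, hu1, hj, Nat.cast_ofNat] at key
  obtain ⟨a, ha'⟩ : ∃ a, P.ord x = 2 * a + 1 := ⟨P.ord x / 2, by omega⟩
  obtain ⟨b, hb'⟩ : ∃ b, P.ord (σ x) = 2 * b + 1 := ⟨P.ord (σ x) / 2, by omega⟩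
  by_contra hne
  -- two consecutive candidates, one of which is nonzero
  have k1 := key (3 * (min a b - j) + 2) (by omega) (by omega) (by omega)
  have k2 := key (3 * (min a b - j) + 3) (by omega) (by omega) (by omega)
  omega

/-- Of the conjugates of a uniformizer exactly two have odd value; arrange the values as α, α, β
with β even. The quotient σx/σ²x and its conjugate σ²x/x have odd values α - β and β - α, while the
third conjugate has value 0. Equality of the odd values gives α = β, against parity. -/
theorem false_of_ramificationIdx_eq_two (hσ3 : ∀ x, σ (σ (σ x)) = x) : False := by
  obtain ⟨z, hz, hz1⟩ := P.exists_ord_eq_one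
  obtain ⟨x, hx, ha, hb, hc⟩ : ∃ x : L, x ≠ 0 ∧ P.ord x % 2 = 1 ∧ P.ord (σ x) % 2 = 1 ∧
      P.ord (σ (σ x)) % 2 = 0 := by
    have := even_sum_ord hσ h h2 hz
    rcases Int.emod_two_eq_zero_or_one (P.ord (σ z)) with h0 | h0
    · refine ⟨σ (σ z), by simpa using hz, by omega, ?_, ?_⟩ <;> rw [hσ3] <;> omega
    · exact ⟨z, hz, by omega, by omega, by omega⟩
  have h1 : σ x ≠ 0 := by simpa using hx
  have h3 : σ (σ x) ≠ 0 := by simpa using hx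
  have e1 := ord_eq_ord_of_odd hσ h h2 hx ha hb hc
  have e2 := ord_eq_ord_of_odd hσ h h2 (x := σ x / σ (σ x)) (div_ne_zero h1 h3)
  simp only [map_div₀, hσ3, P.ord_div h1 h3, P.ord_div h3 hx, P.ord_div hx h1] at e2
  have := e2 (by omega) (by omega) (by omega)
  omega

end IndexTwo

section IndexThree

variable (h : P.LiesOver p) (h3 : P.ramificationIdx p = 3)
include h h3

/-- The coefficients of the equation of an element whose value is positive and prime to the
ramification index. -/
theorem v_coeff_pos {x : L} (hx : x ≠ 0) (hpos : 0 < P.ord x) (hmod : P.ord x % 3 ≠ 0) {A B C' : K}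
    (heq : x ^ 3 + algebraMap K L A * x ^ 2 + algebraMap K L B * x + algebraMap K L C' = 0) :
    0 < p.v A ∧ 0 < p.v B ∧ 0 < p.v C' := by
  have hA : A ≠ 0 → algebraMap K L A * x ^ 2 ≠ 0 ∧
      P.ord (algebraMap K L A * x ^ 2) = 3 * p.ord A + 2 * P.ord x := fun h0 =>
    ⟨mul_ne_zero ((_root_.map_ne_zero _).2 h0) (pow_ne_zero _ hx), by
      simpa [h3] using h.ord_algebraMap_mul_pow h0 hx 2⟩
  have hB : B ≠ 0 → algebraMap K L B * x ≠ 0 ∧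
      P.ord (algebraMap K L B * x) = 3 * p.ord B + P.ord x := fun h0 =>
    ⟨mul_ne_zero ((_root_.map_ne_zero _).2 h0) hx, by
      simpa [h3] using h.ord_algebraMap_mul_pow h0 hx 1⟩
  have hC : C' ≠ 0 → algebraMap K L C' ≠ 0 ∧ P.ord (algebraMap K L C') = 3 * p.ord C' := fun h0 =>
    ⟨(_root_.map_ne_zero _).2 h0, by rw [h.ord_algebraMap, h3]; rfl⟩
  have hx3 : x ^ 3 ≠ 0 := pow_ne_zero _ hx
  have hX : P.ord (x ^ 3) = 3 * P.ord x := by simpa using P.ord_pow hx 3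
  -- the two middle terms have distinct values
  have hmid : P.v (algebraMap K L A * x ^ 2 + algebraMap K L B * x) =
      min (P.v (algebraMap K L A * x ^ 2)) (P.v (algebraMap K L B * x)) := by
    by_cases hA0 : A = 0
    · simp [hA0]
    by_cases hB0 : B = 0
    · simp [hB0]
    refine P.v.map_add_of_distinct_val ?_
    rw [P.v_eq_ord (hA hA0).1, P.v_eq_ord (hB hB0).1, (hA hA0).2, (hB hB0).2]
    intro h'
    have := WithTop.coe_injective h'
    omega
  have hsum : algebraMap K L A * x ^ 2 + algebraMap K L B * x = -(x ^ 3 + algebraMap K L C') := by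
    linear_combination heq
  -- The values of x³ and C' are 0 mod 3, those of Ax² and Bx are not. If the first two differed,
  -- the two halves of the equation could not have equal value.
  have hv : P.v (algebraMap K L C') = P.v (x ^ 3) := by
    by_contra hne
    have h1 := P.v.map_add_of_distinct_val hne
    rw [add_comm, ← P.v.map_neg, ← hsum, hmid] at h1
    rcases min_choice (P.v (algebraMap K L A * x ^ 2)) (P.v (algebraMap K L B * x)) with e1 | e1 <;>
    rcases min_choice (P.v (algebraMap K L C')) (P.v (x ^ 3)) with e2 | e2 <;>
    rw [e1, e2] at h1
    all_goals
      have e3 : P.v (x ^ 3) ≠ ⊤ := P.v.ne_top_iff.2 hx3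
      have e4 := min_le_right (P.v (algebraMap K L C')) (P.v (x ^ 3))
      have e5 : min (P.v (algebraMap K L C')) (P.v (x ^ 3)) ≠ ⊤ :=
        ne_top_of_le_ne_top e3 e4
      rw [e2] at e5
      have e6 := P.v.ne_top_iff.1 e5
      have e7 := P.v.ne_top_iff.1 (h1 ▸ e5)
      rw [P.v_eq_ord e6, P.v_eq_ord e7, WithTop.coe_inj] at h1
      have hA' : algebraMap K L A * x ^ 2 ≠ 0 → A ≠ 0 := by rintro h' rfl; simp at h'
      have hB' : algebraMap K L B * x ≠ 0 → B ≠ 0 := by rintro h' rfl; simp at h'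
      have hC' : algebraMap K L C' ≠ 0 → C' ≠ 0 := by rintro h' rfl; simp at h'
    · have := (hA (hA' e7)).2
      have := (hC (hC' e6)).2
      omega
    · have := (hA (hA' e7)).2
      omega
    · have := (hB (hB' e7)).2
      have := (hC (hC' e6)).2
      omega
    · have := (hB (hB' e7)).2
      omega
  have hC0 : C' ≠ 0 := by
    rintro rfl
    rw [map_zero, P.v.map_zero] at hv
    exact P.v.ne_top_iff.2 hx3 hv.symm
  -- With n the value of x, this yields 3v(A) ≥ n and 3v(B) ≥ 2n.
  have hge : P.v (x ^ 3) ≤ min (P.v (algebraMap K L A * x ^ 2)) (P.v (algebraMap K L B * x)) := by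
    rw [← hmid, hsum, P.v.map_neg]
    exact P.v.map_le_add le_rfl hv.ge
  rw [P.v_eq_ord hx3, hX] at hge hv
  refine ⟨?_, ?_, ?_⟩
  · by_cases hA0 : A = 0
    · simp [hA0]
    have := hge.trans (min_le_left _ _)
    rw [P.v_eq_ord (hA hA0).1, WithTop.coe_le_coe, (hA hA0).2] at this
    rw [p.v_pos_iff hA0]
    omega
  · by_cases hB0 : B = 0
    · simp [hB0]
    have := hge.trans (min_le_right _ _)
    rw [P.v_eq_ord (hB hB0).1, WithTop.coe_le_coe, (hB hB0).2] at this
    rw [p.v_pos_iff hB0]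
    omega
  · rw [P.v_eq_ord (hC hC0).1, WithTop.coe_inj, (hC hC0).2] at hv
    rw [p.v_pos_iff hC0]
    omega

/-- An element integral at `P` is congruent to an element of `K`, with a difference whose value is
not divisible by `3`. -/
theorem exists_sub_algebraMap [FiniteDimensional K L] (hcubic : Module.finrank K L = 3) {y : L}
    (hy : y ∉ (algebraMap K L).range) (hv : 0 ≤ P.v y) : ∃ c : K, 0 ≤ p.v c ∧
      0 < P.ord (y - algebraMap K L c) ∧ P.ord (y - algebraMap K L c) % 3 ≠ 0 := by
  obtain ⟨x, hx, hx1⟩ := P.exists_ord_eq_one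
  have hli := h.linearIndependent_pow hx hx1
  have hspan := hli.span_eq_top_of_card_eq_finrank' (by rw [Fintype.card_fin, h3, hcubic])
  obtain ⟨c, hc⟩ := (Submodule.mem_span_range_iff_exists_fun K).1 (hspan ▸ Submodule.mem_top : y ∈ _)
  simp only [Algebra.smul_def] at hc
  have h1 := h.v_sum hx hx1 c Finset.univ
  rw [hc] at h1
  have hle : ∀ i, 0 ≤ P.v (algebraMap K L (c i) * x ^ (i : ℕ)) := fun i =>
    hv.trans (h1.le.trans (Finset.inf_le (Finset.mem_univ i)))
  let i0 : Fin (P.ramificationIdx p) := ⟨0, by omega⟩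
  let i1 : Fin (P.ramificationIdx p) := ⟨1, by omega⟩
  let i2 : Fin (P.ramificationIdx p) := ⟨2, by omega⟩
  have huniv : (Finset.univ : Finset (Fin (P.ramificationIdx p))) = {i0, i1, i2} := by
    ext ⟨i, hi⟩
    simp only [Finset.mem_univ, Finset.mem_insert, Finset.mem_singleton, true_iff, i0, i1, i2,
      Fin.mk.injEq]
    omega
  have hne : i0 ∉ ({i1, i2} : Finset (Fin (P.ramificationIdx p))) := by
    simp [i0, i1, i2]
  -- Without its constant term the expansion of y in 1, x, x² has value 1 or 2 mod 3, and this value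
  -- is nonnegative because no term can have smaller value than y.
  have hsub : y - algebraMap K L (c i0) =
      ∑ i ∈ ({i1, i2} : Finset (Fin (P.ramificationIdx p))),
        algebraMap K L (c i) * x ^ (i : ℕ) := by
    rw [← hc, huniv, Finset.sum_insert hne]
    simp [i0]
  have h0 : y - algebraMap K L (c i0) ≠ 0 := fun h' => hy ⟨_, (sub_eq_zero.1 h').symm⟩
  refine ⟨c i0, ?_, ?_⟩
  · exact (h _).1 (by simpa [i0] using hle i0)
  · obtain ⟨i, hi, hie⟩ := Finset.exists_mem_eq_inf
      ({i1, i2} : Finset (Fin (P.ramificationIdx p))) ⟨i1, by simp⟩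
      fun i => P.v (algebraMap K L (c i) * x ^ (i : ℕ))
    have h2 := h.v_sum hx hx1 c {i1, i2}
    rw [hie, ← hsub] at h2
    have hi0 := P.v.ne_top_iff.1 (h2 ▸ P.v.ne_top_iff.2 h0)
    have hci : c i ≠ 0 := fun h' => hi0 (by simp [h'])
    have h4 := hle i
    have he : (P.ramificationIdx p : ℤ) = 3 := by exact_mod_cast h3
    rw [P.v_nonneg_iff hi0, h.ord_algebraMap_mul_pow hci hx, hx1, he] at h4
    rw [P.v_eq_ord h0, P.v_eq_ord hi0, WithTop.coe_inj, h.ord_algebraMap_mul_pow hci hx, hx1,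
      he] at h2
    have hi' : (i : ℕ) = 1 ∨ (i : ℕ) = 2 := by
      rcases Finset.mem_insert.1 hi with rfl | hi
      · exact Or.inl rfl
      · rw [Finset.mem_singleton.1 hi]
        exact Or.inr rfl
    rw [h2]
    omega

/-- The equation of y - c has coefficients 3c, 3c² + b and c³ + bc + d, all of positive value. As 3
is a unit, positivity passes successively to c, b and d. -/
theorem v_coeff_pos_of_depressed [FiniteDimensional K L] (hcubic : Module.finrank K L = 3)
    (hk : (3 : k) ≠ 0) {y : L} (hy : y ∉ (algebraMap K L).range) (hv : 0 ≤ P.v y) {b d : K}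
    (heq : y ^ 3 + algebraMap K L b * y + algebraMap K L d = 0) : 0 < p.v b ∧ 0 < p.v d := by
  obtain ⟨c, hc, hpos, hmod⟩ := exists_sub_algebraMap h h3 hcubic hy hv
  have h0 : y - algebraMap K L c ≠ 0 := fun h' => hy ⟨_, (sub_eq_zero.1 h').symm⟩
  obtain ⟨hA, hB, hC⟩ := v_coeff_pos h h3 h0 hpos hmod (A := 3 * c) (B := 3 * c ^ 2 + b)
    (C' := c ^ 3 + b * c + d) (by
      simp only [map_mul, map_add, map_pow, map_ofNat]
      linear_combination heq)
  rw [p.v.map_mul, p.v_three hk, zero_add] at hA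
  have hc2 : 0 < p.v (3 * c ^ 2) := by
    rw [show 3 * c ^ 2 = c * (3 * c) by ring]
    refine p.v_pos_mul hA ?_
    rw [p.v.map_mul, p.v_three hk, zero_add]
    exact hc
  have hb : 0 < p.v b := by
    rw [show b = (3 * c ^ 2 + b) + -(3 * c ^ 2) by ring]
    exact p.v.map_lt_add hB (by rwa [p.v.map_neg])
  refine ⟨hb, ?_⟩
  rw [show d = (c ^ 3 + b * c + d) + -(c * (c ^ 2 + b)) by ring]
  refine p.v.map_lt_add hC ?_
  rw [p.v.map_neg]
  refine p.v_pos_mul hA (p.v.map_le_add ?_ hb.le)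
  rw [sq]
  exact (p.v_pos_mul hA hc).le

end IndexThree

end Place

/-! ### Extending a discrete valuation through the integral closure -/

namespace IsDedekindDomain.HeightOneSpectrum

variable {B L : Type*} [CommRing B] [IsDedekindDomain B] [Field L] [Algebra B L] [IsFractionRing B L]

open Classical in
/-- The adic valuation of a maximal ideal of a Dedekind domain, written additively. -/
noncomputable def addValuation (M : HeightOneSpectrum B) : AddValuation L (WithTop ℤ) :=
  AddValuation.of
    -- Zero needs its own clause because `WithZero.log` sends 0 to 0; the sign reverses the
    -- multiplicative order.
    (fun x => if x = 0 then ⊤ else ((-(M.valuation L x).log : ℤ) : WithTop ℤ))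
    (by simp) (by simp)
    (by
      intro x y
      by_cases hx : x = 0
      · simp [hx]
      by_cases hy : y = 0
      · simp [hy]
      by_cases hxy : x + y = 0
      · simp [hxy]
      simp only [hx, hy, hxy, if_false, ← WithTop.coe_min, WithTop.coe_le_coe]
      have hx' := (M.valuation L).ne_zero_iff.2 hx
      have hy' := (M.valuation L).ne_zero_iff.2 hy
      have hxy' := (M.valuation L).ne_zero_iff.2 hxy
      have := (M.valuation L).map_add x y
      rcases le_max_iff.1 this with h | h
      · have := (WithZero.log_le_log hxy' hx').2 h
        omega
      · have := (WithZero.log_le_log hxy' hy').2 h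
        omega)
    (by
      intro x y
      by_cases hx : x = 0
      · simp [hx]
      by_cases hy : y = 0
      · simp [hy]
      have hx' := (M.valuation L).ne_zero_iff.2 hx
      have hy' := (M.valuation L).ne_zero_iff.2 hy
      simp only [hx, hy, mul_eq_zero, or_self, if_false, map_mul, WithZero.log_mul hx' hy',
        ← WithTop.coe_add, WithTop.coe_inj]
      ring)

theorem addValuation_apply (M : HeightOneSpectrum B) {x : L} (hx : x ≠ 0) :
    M.addValuation x = ((-(M.valuation L x).log : ℤ) : WithTop ℤ) :=
  if_neg hx

theorem addValuation_surjective (M : HeightOneSpectrum B) :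
    Function.Surjective (M.addValuation : AddValuation L (WithTop ℤ)) := by
  intro n
  cases n with
  | top => exact ⟨0, AddValuation.map_zero _⟩
  | coe n =>
    obtain ⟨x, hx⟩ := M.valuation_surjective L (WithZero.exp (-n))
    have hx0 : x ≠ 0 := by
      rintro rfl
      rw [map_zero] at hx
      exact WithZero.exp_ne_zero hx.symm
    exact ⟨x, by rw [addValuation_apply M hx0, hx, WithZero.log_exp, neg_neg]⟩

theorem addValuation_nonneg (M : HeightOneSpectrum B) (b : B) :
    0 ≤ (M.addValuation (algebraMap B L b)) := by
  by_cases hb : algebraMap B L b = 0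
  · simp [hb]
  rw [addValuation_apply M hb, ← WithTop.coe_zero, WithTop.coe_le_coe]
  have := (WithZero.log_le_log ((M.valuation L).ne_zero_iff.2 hb) one_ne_zero).2
    (M.valuation_le_one b)
  rw [WithZero.log_one] at this
  omega

theorem addValuation_pos (M : HeightOneSpectrum B) {b : B} (h : b ∈ M.asIdeal) :
    0 < (M.addValuation (algebraMap B L b)) := by
  by_cases hb : algebraMap B L b = 0
  · simp [hb]
  rw [addValuation_apply M hb, ← WithTop.coe_zero, WithTop.coe_lt_coe]
  have := (WithZero.log_lt_log ((M.valuation L).ne_zero_iff.2 hb) one_ne_zero).2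
    ((M.valuation_lt_one_iff_mem b).2 h)
  rw [WithZero.log_one] at this
  omega

end IsDedekindDomain.HeightOneSpectrum

/-- A discrete valuation ring extends to a finite separable extension of its field of fractions. -/
theorem exists_addValuation_of_isLocalRing (A K L : Type*) [CommRing A] [IsDedekindDomain A]
    [IsLocalRing A] (hA : ¬ IsField A) [Field K] [Algebra A K] [IsFractionRing A K] [Field L]
    [Algebra A L] [Algebra K L] [IsScalarTower A K L] [FiniteDimensional K L]
    [Algebra.IsSeparable K L] :
    ∃ w : AddValuation L (WithTop ℤ), Function.Surjective w ∧
      (∀ a : A, 0 ≤ w (algebraMap A L a)) ∧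
      ∀ a ∈ IsLocalRing.maximalIdeal A, 0 < w (algebraMap A L a) := by
  have := integralClosure.isDedekindDomain A K L
  have := integralClosure.isFractionRing_of_finite_extension (A := A) K L
  have hinj : Function.Injective (algebraMap A L) := by
    rw [IsScalarTower.algebraMap_eq A K L]
    exact (algebraMap K L).injective.comp (IsFractionRing.injective A K)
  have hinjB : Function.Injective (algebraMap A (integralClosure A L)) := by
    rw [IsScalarTower.algebraMap_eq A (integralClosure A L) L] at hinj
    exact Function.Injective.of_comp (f := algebraMap (integralClosure A L) L) hinj
  -- Lying over: Q is nonzero since it contains the image of the nonzero maximal ideal of A, so it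
  -- has an adic valuation.
  obtain ⟨Q, hQ, hQA⟩ := Ideal.exists_ideal_over_maximal_of_isIntegral
    (S := integralClosure A L) (IsLocalRing.maximalIdeal A)
    (by rw [(RingHom.injective_iff_ker_eq_bot _).1 hinjB]; exact bot_le)
  have hmem : ∀ a ∈ IsLocalRing.maximalIdeal A, algebraMap A (integralClosure A L) a ∈ Q := by
    intro a ha
    rwa [← hQA] at ha
  have hbot : Q ≠ ⊥ := by
    rintro rfl
    refine hA (IsLocalRing.isField_iff_maximalIdeal_eq.2 ?_)
    rw [eq_bot_iff]
    intro a ha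
    exact (map_eq_zero_iff _ hinjB).1 ((Submodule.mem_bot _).1 (hmem a ha))
  let M : IsDedekindDomain.HeightOneSpectrum (integralClosure A L) := ⟨Q, hQ.isPrime, hbot⟩
  exact ⟨M.addValuation, M.addValuation_surjective,
    fun a => M.addValuation_nonneg (algebraMap A (integralClosure A L) a),
    fun a ha => M.addValuation_pos (hmem a ha)⟩

/-! ### The valuation ring of a place and existence of places above it -/

namespace Place

variable {k K L : Type*} [Field k] [Field K] [Field L] [Algebra k K] [Algebra k L] [Algebra K L]

/-- The valuation ring of a place. -/
noncomputable def valuationRing (p : Place k K) : ValuationSubring K :=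
  (AddValuation.toValuation p.v).valuationSubring

theorem mem_valuationRing (p : Place k K) {x : K} : x ∈ p.valuationRing ↔ 0 ≤ p.v x :=
  Iff.rfl

theorem v_eq_zero_iff_isUnit (p : Place k K) (x : p.valuationRing) :
    IsUnit x ↔ p.v (x : K) = 0 := by
  constructor
  · rintro ⟨u, rfl⟩
    have h1 : p.v ((u : p.valuationRing) : K) + p.v ((u⁻¹ : p.valuationRingˣ) : p.valuationRing)
        = 0 := by
      rw [← p.v.map_mul, ← MulMemClass.coe_mul, Units.mul_inv]
      exact p.v.map_one
    have h2 : 0 ≤ p.v ((u : p.valuationRing) : K) := (u : p.valuationRing).2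
    have h3 : 0 ≤ p.v (((u⁻¹ : p.valuationRingˣ) : p.valuationRing) : K) :=
      ((u⁻¹ : p.valuationRingˣ) : p.valuationRing).2
    exact le_antisymm (h1 ▸ le_add_of_nonneg_right h3) h2
  · intro hx
    have hx0 : (x : K) ≠ 0 := p.ne_zero_of_v_eq (n := 0) hx
    have hinv : p.v (x : K)⁻¹ = 0 := by
      have h1 := p.v.map_mul (x : K) (x : K)⁻¹
      rw [mul_inv_cancel₀ hx0, p.v.map_one, hx, zero_add] at h1
      exact h1.symm
    exact IsUnit.of_mul_eq_one ⟨(x : K)⁻¹, p.mem_valuationRing.2 hinv.ge⟩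
      (Subtype.ext (mul_inv_cancel₀ hx0))

/-- An element of value n is a unit times tⁿ, where t has value 1. -/
instance isDiscreteValuationRing_valuationRing (p : Place k K) :
    IsDiscreteValuationRing p.valuationRing := by
  apply IsDiscreteValuationRing.ofHasUnitMulPowIrreducibleFactorization
  obtain ⟨t, ht, ht1⟩ := p.exists_ord_eq_one
  have htm : t ∈ p.valuationRing := by
    rw [mem_valuationRing, p.v_nonneg_iff ht, ht1]
    exact zero_le_one
  have hunit : ∀ x : p.valuationRing, (x : K) ≠ 0 → (IsUnit x ↔ p.ord (x : K) = 0) := by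
    intro x hx
    rw [v_eq_zero_iff_isUnit, ← p.v_eq_coe_iff hx]
    rfl
  refine ⟨⟨t, htm⟩, ⟨?_, ?_⟩, ?_⟩
  · rw [hunit _ ht]
    simp [ht1]
  · intro a b hab
    have hab' : t = (a : K) * b := congrArg Subtype.val hab
    have ha0 : (a : K) ≠ 0 := by
      intro h0
      simp [h0, ht] at hab'
    have hb0 : (b : K) ≠ 0 := by
      intro h0
      simp [h0, ht] at hab'
    have ha := (p.v_nonneg_iff ha0).1 a.2
    have hb := (p.v_nonneg_iff hb0).1 b.2
    rw [hab', p.ord_mul ha0 hb0] at ht1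
    rw [hunit a ha0, hunit b hb0]
    omega
  · intro x hx
    have hx0 : (x : K) ≠ 0 := fun h0 => hx (Subtype.ext h0)
    have hxv := (p.v_nonneg_iff hx0).1 x.2
    obtain ⟨n, hn⟩ := Int.eq_ofNat_of_zero_le hxv
    refine ⟨n, ?_⟩
    have hq0 : (x : K) / t ^ n ≠ 0 := div_ne_zero hx0 (pow_ne_zero _ ht)
    have hq : p.ord ((x : K) / t ^ n) = 0 := by
      rw [p.ord_div hx0 (pow_ne_zero _ ht), p.ord_pow ht, ht1, hn]
      simp
    have hqm : (x : K) / t ^ n ∈ p.valuationRing := by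
      rw [mem_valuationRing, p.v_nonneg_iff hq0, hq]
    obtain ⟨u, hu⟩ := (hunit ⟨_, hqm⟩ hq0).2 hq
    refine ⟨u, Subtype.ext ?_⟩
    have hu' : ((u : p.valuationRing) : K) = (x : K) / t ^ n := congrArg Subtype.val hu
    push_cast
    rw [hu']
    field_simp

/-- Every place extends to a finite separable extension. -/
theorem exists_liesOver (L : Type*) [Field L] [Algebra k L] [Algebra K L] [IsScalarTower k K L]
    [FiniteDimensional K L] [Algebra.IsSeparable K L] (p : Place k K) :
    ∃ P : Place k L, P.LiesOver p := by
  let _ : Algebra p.valuationRing L :=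
    ((algebraMap K L).comp (algebraMap p.valuationRing K)).toAlgebra
  have : IsScalarTower p.valuationRing K L := IsScalarTower.of_algebraMap_eq fun _ => rfl
  obtain ⟨w, hsurj, hnonneg, hpos⟩ := exists_addValuation_of_isLocalRing p.valuationRing K L
    (IsDiscreteValuationRing.not_isField _)
  have hmul : ∀ {x : L}, x ≠ 0 → w x + w x⁻¹ = 0 := fun {x} hx => by
    rw [← w.map_mul, mul_inv_cancel₀ hx, w.map_one]
  have hnn : ∀ z : K, 0 ≤ p.v z → 0 ≤ w (algebraMap K L z) := fun z hz => hnonneg ⟨z, hz⟩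
  refine ⟨⟨w, hsurj, ?_⟩, fun z => ⟨?_, hnn z⟩⟩
  · intro c hc
    have h1 := hnn _ (p.v_const c hc).ge
    have h2 := hnn _ (p.v_const c⁻¹ (inv_ne_zero hc)).ge
    rw [← IsScalarTower.algebraMap_apply] at h1 h2
    rw [map_inv₀] at h2
    have h3 := hmul (x := algebraMap k L c) ((_root_.map_ne_zero _).2 hc)
    exact le_antisymm (h3 ▸ le_add_of_nonneg_right h2) h1
  · intro hz
    -- If z had a pole at p, then z⁻¹ would lie in the maximal ideal and have positive value at w,
    -- so z could not be integral there.
    by_contra! hneg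
    have hz0 : z ≠ 0 := by
      rintro rfl
      simp at hneg
    have hord : p.ord z < 0 := by
      rw [p.v_eq_ord hz0] at hneg
      exact WithTop.coe_lt_coe.1 hneg
    have hinv : 0 < p.ord z⁻¹ := by
      rw [← zpow_neg_one, p.ord_zpow hz0]
      omega
    have hzi := inv_ne_zero hz0
    have hmem : z⁻¹ ∈ p.valuationRing := (p.v_nonneg_iff hzi).2 hinv.le
    have h1 := hpos ⟨z⁻¹, hmem⟩ (by
      rw [IsLocalRing.mem_maximalIdeal, mem_nonunits_iff, v_eq_zero_iff_isUnit]
      exact ((p.v_pos_iff hzi).2 hinv).ne')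
    have h2 : 0 < w (algebraMap K L z⁻¹) := h1
    have h3 := hmul (x := algebraMap K L z) ((_root_.map_ne_zero _).2 hz0)
    rw [← map_inv₀] at h3
    have h4 := add_pos_of_pos_of_nonneg h2 hz
    rw [add_comm, h3] at h4
    exact lt_irrefl _ h4

end Place

/-! ### Ramification in terms of the order of a -/

namespace Place

variable {k K L : Type*} [Field k] [Field K] [Field L] [Algebra k K] [Algebra k L] [Algebra K L]
  {P : Place k L} {p : Place k K}

theorem LiesOver.ramificationIdx_eq_three [IsGalois K L] (hcubic : Module.finrank K L = 3)
    (h : P.LiesOver p) (he : 1 < P.ramificationIdx p) : P.ramificationIdx p = 3 := by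
  have : FiniteDimensional K L := Module.finite_of_finrank_pos (by omega)
  obtain ⟨σ, hσ3, hσ⟩ := exists_generator_of_finrank_eq_three (K := K) (L := L) hcubic
  have h1 := h.ramificationIdx_le_finrank
  have h2 : P.ramificationIdx p ≠ 2 := fun h2 => false_of_ramificationIdx_eq_two hσ h h2 hσ3
  omega

theorem isRamified_iff_isFullyRamified [IsGalois K L] (hcubic : Module.finrank K L = 3) :
    p.IsRamified L ↔ p.IsFullyRamified L := by
  constructor
  · rintro ⟨P, h, he⟩
    exact ⟨P, h, by rw [h.ramificationIdx_eq_three hcubic he, hcubic]⟩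
  · rintro ⟨P, h, he⟩
    exact ⟨P, h, by omega⟩

/-- A totally ramified place is a pole of `a`, of order prime to `3`. -/
theorem LiesOver.exists_v_eq_of_ramificationIdx_eq_three [FiniteDimensional K L]
    (hcubic : Module.finrank K L = 3) (hk : (3 : k) ≠ 0) {y : L} (hy : y ∉ (algebraMap K L).range)
    {a : K} (heq : y ^ 3 - 3 * y - algebraMap K L a = 0) (h : P.LiesOver p)
    (he : P.ramificationIdx p = 3) : ∃ n : ℤ, p.v a = n ∧ n < 0 ∧ Int.gcd n 3 = 1 := by
  have hv3 : p.v (-3 : K) = 0 := by rw [p.v.map_neg, p.v_three hk]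
  by_cases hneg : 0 ≤ p.v a
  · exfalso
    have heq' : y ^ 3 + algebraMap K L (-3) * y + algebraMap K L (-a) = 0 := by
      rw [map_neg, map_neg, map_ofNat]
      linear_combination heq
    have hvy : 0 ≤ P.v y := P.v_nonneg_of_cubic heq' ((h _).2 hv3.ge)
      ((h _).2 (by rwa [p.v.map_neg]))
    -- The linear coefficient -3 is a unit, so it cannot have positive value.
    exact (v_coeff_pos_of_depressed h he hcubic hk hy hvy heq').1.ne' hv3
  · have ha : a ≠ 0 := by
      rintro rfl
      simp at hneg
    rw [p.v_nonneg_iff ha, not_le] at hneg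
    refine ⟨p.ord a, p.v_eq_ord ha, hneg, ?_⟩
    by_contra hgcd
    have hdvd : (3 : ℤ) ∣ p.ord a := by
      have h1 : Int.gcd (p.ord a) 3 ∣ 3 := by exact_mod_cast Int.gcd_dvd_right (p.ord a) 3
      have h2 := ((Nat.dvd_prime Nat.prime_three).1 h1).resolve_left hgcd
      have h3 := Int.gcd_dvd_left (p.ord a) 3
      rwa [h2] at h3
    obtain ⟨m, hm⟩ := hdvd
    -- Here v(a) = -3s. Scaling y by tˢ keeps the cubic integral and turns its constant term into a
    -- unit, which cannot have positive value.
    obtain ⟨s, hs⟩ : ∃ s : ℕ, m = -s := ⟨(-m).toNat, by omega⟩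
    obtain ⟨t, ht, ht1⟩ := p.exists_ord_eq_one
    have hts : t ^ s ≠ 0 := pow_ne_zero _ ht
    have heq' : (algebraMap K L (t ^ s) * y) ^ 3
        + algebraMap K L (-3 * (t ^ s) ^ 2) * (algebraMap K L (t ^ s) * y)
        + algebraMap K L (-(a * (t ^ s) ^ 3)) = 0 := by
      simp only [map_neg, map_mul, map_pow, map_ofNat]
      linear_combination (algebraMap K L t ^ s) ^ 3 * heq
    have hy' : algebraMap K L (t ^ s) * y ∉ (algebraMap K L).range := by
      rintro ⟨c, hc⟩
      refine hy ⟨c / t ^ s, ?_⟩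
      rw [map_div₀, hc, mul_div_cancel_left₀ _ ((_root_.map_ne_zero _).2 hts)]
    have hb : 0 ≤ p.v (-3 * (t ^ s) ^ 2) := by
      rw [p.v.map_mul, hv3, zero_add, p.v_nonneg_iff (pow_ne_zero _ hts), p.ord_pow hts,
        p.ord_pow ht, ht1]
      positivity
    have hd : p.v (-(a * (t ^ s) ^ 3)) = 0 := by
      rw [p.v.map_neg, ← WithTop.coe_zero,
        p.v_eq_coe_iff (mul_ne_zero ha (pow_ne_zero _ hts)),
        p.ord_mul ha (pow_ne_zero _ hts), p.ord_pow hts, p.ord_pow ht, ht1]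
      push_cast
      omega
    have hvy := P.v_nonneg_of_cubic heq' ((h _).2 hb) ((h _).2 hd.ge)
    exact (v_coeff_pos_of_depressed h he hcubic hk hy' hvy heq').2.ne' hd

/-- A pole of `a` of order prime to `3` has ramification index divisible by `3`. -/
theorem LiesOver.three_dvd_ramificationIdx (hk : (3 : k) ≠ 0) {y : L} {a : K}
    (heq : y ^ 3 - 3 * y - algebraMap K L a = 0) (h : P.LiesOver p) {n : ℤ} (hn : p.v a = n)
    (hneg : n < 0) (hgcd : Int.gcd n 3 = 1) : 3 ∣ P.ramificationIdx p := by
  have he := (ramificationIdx_spec P p h).1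
  have ha := p.ne_zero_of_v_eq hn
  have haL : algebraMap K L a ≠ 0 := (_root_.map_ne_zero _).2 ha
  have hord : P.ord (algebraMap K L a) = P.ramificationIdx p * n := by
    rw [h.ord_algebraMap, p.ord_eq_of_v_eq hn]
  have hlt : P.ord (algebraMap K L a) < 0 := by
    rw [hord]
    exact mul_neg_of_pos_of_neg (by exact_mod_cast he) hneg
  have hy : y ≠ 0 := by
    rintro rfl
    exact haL (by linear_combination -heq)
  have h3v := P.v_three hk
  have h30 : (3 : L) ≠ 0 := P.ne_zero_of_v_eq (n := 0) h3v
  have ho3 : P.ord (-3 * y) = P.ord y := by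
    rw [P.ord_mul (neg_ne_zero.2 h30) hy, P.ord_eq_of_v_eq (n := 0) (by rw [P.v.map_neg]; exact h3v),
      zero_add]
  have hcube : P.ord (y ^ 3) = 3 * P.ord y := by simpa using P.ord_pow hy 3
  have hsum : y ^ 3 + -3 * y = algebraMap K L a := by linear_combination heq
  -- An integral y would make a integral. Once y has a pole, 3v(y) < v(y) and the cube alone
  -- determines the value of a.
  have hy0 : P.ord y < 0 := by
    by_contra! hge
    have hvy := (P.v_nonneg_iff hy).2 hge
    have h1 : 0 ≤ P.v (y ^ 3 + -3 * y) := by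
      refine P.v.map_le_add ?_ ?_
      · rw [P.v_nonneg_iff (pow_ne_zero _ hy), hcube]
        omega
      · rw [P.v_nonneg_iff (mul_ne_zero (neg_ne_zero.2 h30) hy), ho3]
        exact hge
    rw [hsum, P.v_nonneg_iff haL] at h1
    omega
  have h2 := (P.ord_add_of_ne (pow_ne_zero 3 hy) (mul_ne_zero (neg_ne_zero.2 h30) hy)
    (by rw [hcube, ho3]; omega)).2
  rw [hsum, hcube, ho3, hord, min_eq_left (by omega)] at h2
  have hcop : IsCoprime (3 : ℤ) n := (Int.isCoprime_iff_gcd_eq_one.2 hgcd).symm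
  exact_mod_cast hcop.dvd_of_dvd_mul_right (⟨_, h2⟩ : (3 : ℤ) ∣ P.ramificationIdx p * n)

end Place

theorem mainTheorem10 {k K L : Type*} [Field k] [Finite k] [Field K] [Field L]
    [Algebra (RatFunc k) K] [FunctionField k K]
    [Algebra k K] [IsScalarTower k (RatFunc k) K] (hconst : algebraicClosure k K = ⊥)
    (hq : (Nat.card k : ℤ) ≡ -1 [ZMOD 3])
    [Algebra K L] [Algebra k L] [IsScalarTower k K L]
    [IsGalois K L] (hcubic : Module.finrank K L = 3) :
    (∃ (y : L) (a : K), K⟮y⟯ = ⊤ ∧ minpoly K y = X ^ 3 - 3 * X - C a) ∧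
    ∀ (y : L) (a : K), K⟮y⟯ = ⊤ → minpoly K y = X ^ 3 - 3 * X - C a →
      ∀ p : Place k K,
        (p.IsRamified L ↔ p.IsFullyRamified L) ∧
        (p.IsRamified L ↔ ∃ n : ℤ, p.v a = n ∧ n < 0 ∧ Int.gcd n 3 = 1) := by
  have : FiniteDimensional K L := Module.finite_of_finrank_pos (by omega)
  have hk := three_ne_zero_of_card hq
  have hK : (3 : K) ≠ 0 := by
    rw [← map_ofNat (algebraMap k K)]
    exact (_root_.map_ne_zero _).2 hk
  refine ⟨exists_minpoly_eq_X_pow_three_sub hcubic hK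
    (sq_add_self_add_one_ne_zero_of_algebraicClosure_eq_bot hconst hq), ?_⟩
  intro y a htop hmin p
  have heq : y ^ 3 - 3 * y - algebraMap K L a = 0 := by
    have h := minpoly.aeval K y
    rw [hmin] at h
    simpa only [map_sub, map_mul, map_pow, aeval_X, map_ofNat, aeval_C] using h
  have hy : y ∉ (algebraMap K L).range := by
    intro hy
    rw [IntermediateField.adjoin_simple_eq_bot_iff.2 (IntermediateField.mem_bot.2 hy)] at htop
    have h1 := IntermediateField.finrank_bot (F := K) (E := L)
    rw [htop, IntermediateField.finrank_top', hcubic] at h1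
    omega
  refine ⟨Place.isRamified_iff_isFullyRamified hcubic, ?_, ?_⟩
  · rintro ⟨P, h, he⟩
    exact h.exists_v_eq_of_ramificationIdx_eq_three hcubic hk hy heq
      (h.ramificationIdx_eq_three hcubic he)
  · rintro ⟨n, hn, hneg, hgcd⟩
    obtain ⟨P, h⟩ := p.exists_liesOver L
    have he := (Place.ramificationIdx_spec P p h).1
    have h3 := h.three_dvd_ramificationIdx hk heq hn hneg hgcd
    -- A positive multiple of 3 exceeds 1.
    exact ⟨P, h, by omega⟩
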